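/- Let $k$ be a field, let $S=k[x_1,\ldots,x_n]$ be a polynomial ring in $n$ variables, and let $M$ be a monomial ideal of $S$. A multigraded free resolution $\cdots\to F_1\xrightarrow{f_1}F_0\xrightarrow{f_0}S/M\to 0$ is an exact complex of free $S$-modules $F_i$ with fixed bases, each basis element $[\sigma]$ of $F_i$ having homological degree $i$ and a multidegree $\operatorname{mdeg}[\sigma]$ (a monomial), such that all the maps preserve multidegrees. It is minimal if no matrix of a differential $f_i$ ($i\ge 1$) has an invertible entry. For $i\ge 0$ and a monomial $l$, the multigraded Betti number $\beta_{i,l}(S/M)$ is the number of basis elements of homological degree $i$ and multidegree $l$ in a minimal multigraded free resolution of $S/M$. Suppose that some minimal multigraded free resolution of $S/M$ has a basis element of multidegree $l$ in homological degree $n$, where $n$ is the number of variables of $S$. Then, for every $i\ge 0$, $$\beta_{i,l}(S/M)=\begin{cases}1,&\text{if } i=n,\\ 0,&\text{otherwise,}\end{cases}$$ and the same count holds in every minimal multigraded free resolution of $S/M$: it has exactly one basis element of multidegree $l$ in homological degree $n$, and none of multidegree $l$ in any other homological degree. -/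

import Mathlib

universe u

namespace MonomialResolution

/-- An ideal of `k[x_1, ..., x_n]` generated by a set of monomials. -/
def IsMonomialIdeal {k : Type u} [Field k] {n : ℕ}
    (M : Ideal (MvPolynomial (Fin n) k)) : Prop :=
  ∃ G : Set (Fin n →₀ ℕ), M = Ideal.span ((fun a => MvPolynomial.monomial a (1 : k)) '' G)

/-- A multigraded free resolution
`⋯ → F_{i+1} → F_i → ⋯ → F_0 → S/M → 0` over `S = k[x_1, ..., x_n]`, with a chosen basis of
multihomogeneous elements: `F_i` is the free `S`-module `B i →₀ S` on the set `B i` of basis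
elements of homological degree `i`. A monomial is represented by its exponent vector.
Nothing is assumed about the size of the sets `B i`. -/
structure FreeResolution {k : Type u} [Field k] {n : ℕ}
    (M : Ideal (MvPolynomial (Fin n) k)) where
  /-- the basis elements of homological degree `i` -/
  B : ℕ → Type
  /-- the multidegree of a basis element -/
  mdeg : ∀ i, B i → (Fin n →₀ ℕ)
  /-- the differential `F_{i+1} → F_i` -/
  d : ∀ i, (B (i + 1) →₀ MvPolynomial (Fin n) k) →ₗ[MvPolynomial (Fin n) k]
    (B i →₀ MvPolynomial (Fin n) k)
  /-- the augmentation `F_0 → S/M` -/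
  aug : (B 0 →₀ MvPolynomial (Fin n) k) →ₗ[MvPolynomial (Fin n) k]
    (MvPolynomial (Fin n) k ⧸ M)
  aug_surjective : Function.Surjective aug
  exact_zero : Function.Exact (d 0) aug
  exact_succ : ∀ i, Function.Exact (d (i + 1)) (d i)
  /-- the differentials preserve multidegrees: the matrix entry `a` from `[σ]` to `[τ]` satisfies
  `a * mdeg [τ] = c * mdeg [σ]` for a scalar `c` -/
  d_homogeneous : ∀ (i : ℕ) (σ : B (i + 1)) (τ : B i), ∃ c : k,
    d i (Finsupp.single σ 1) τ * MvPolynomial.monomial (mdeg i τ) 1 =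
      MvPolynomial.monomial (mdeg (i + 1) σ) c
  /-- the augmentation preserves multidegrees -/
  aug_homogeneous : ∀ σ : B 0, ∃ c : k,
    aug (Finsupp.single σ 1) = Ideal.Quotient.mk M (MvPolynomial.monomial (mdeg 0 σ) c)

/-- A resolution is minimal if no differential matrix has an invertible entry. -/
def FreeResolution.IsMinimal {k : Type u} [Field k] {n : ℕ}
    {M : Ideal (MvPolynomial (Fin n) k)} (F : FreeResolution M) : Prop :=
  ∀ (i : ℕ) (σ : F.B (i + 1)) (τ : F.B i), ¬ IsUnit (F.d i (Finsupp.single σ 1) τ)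

/-- The number of basis elements of homological degree `i` and multidegree `l`. -/
noncomputable def FreeResolution.count {k : Type u} [Field k] {n : ℕ}
    {M : Ideal (MvPolynomial (Fin n) k)} (F : FreeResolution M) (i : ℕ) (l : Fin n →₀ ℕ) : ℕ∞ :=
  {σ : F.B i | F.mdeg i σ = l}.encard

open Classical in
/-- The multigraded Betti number `β_{i,l}(S/M)`: the number of basis elements of homological
degree `i` and multidegree `l` in a minimal multigraded free resolution of `S/M`. -/
noncomputable def multigradedBetti {k : Type u} [Field k] {n : ℕ}
    (M : Ideal (MvPolynomial (Fin n) k)) (i : ℕ) (l : Fin n →₀ ℕ) : ℕ∞ :=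
  if h : ∃ F : FreeResolution M, F.IsMinimal then h.choose.count i l else 0

end MonomialResolution

/-! Setting every variable to 1 turns the strand of multidegree `a` of a free module into the span
of the basis elements whose multidegree divides `a`. The strands of multidegrees `l - T`, with `T`
squarefree, are then the coefficients of the degree-`l` part of the Koszul complex, with `T` running
over faces of a simplex. A single generator `σ` with `mdeg σ ≤ l` contributes the full simplex on
the variables where `mdeg σ` lies strictly below `l`. It is acyclic by coning, unless `mdeg σ = l`,
when only the empty face survives (`exists_koszulBoundary_eq`).

Dimension shifting along the syzygies, with minimality keeping generators of multidegree `l` out of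
boundaries, matches the basis elements of homological degree `i + 1` and multidegree `l` with the
homology of the upper Koszul complex of `M` at `l` in faces of `i` vertices
(`nonempty_upperKoszul_equiv`).

A basis element in degree `n` thus gives homology in faces of `n - 1` out of `n` vertices, which
forces the complex to be the boundary of the simplex (`eq_univ_iff_of_nontrivial`). That sphere has
one-dimensional homology there and none elsewhere. The complex depends only on `M` and `l`, so every
minimal resolution has the same counts. Homological degree 0 and the case `n = 0` are treated
directly. -/

namespace MonomialResolution

/-! ### Simplicial chains with coefficients varying over the faces -/

section Koszul

variable {k : Type*} [Field k] {n : ℕ} {V W : Type*} [AddCommGroup V] [Module k V]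
  [AddCommGroup W] [Module k W]

/-- The sign of the vertex `i` relative to the face `T`. -/
def koszulSign (k : Type*) [Field k] {n : ℕ} (i : Fin n) (T : Finset (Fin n)) : k :=
  (-1) ^ (T.filter (· < i)).card

theorem koszulSign_mul_self (i : Fin n) (T : Finset (Fin n)) :
    koszulSign k i T * koszulSign k i T = 1 := by
  rw [koszulSign, ← mul_pow]; simp

/-- Only the smaller of the two vertices is counted in the sign of the other, so exactly one of the
two signs flips. -/
theorem koszulSign_insert_mul {i j : Fin n} {T : Finset (Fin n)} (hij : i ≠ j)
    (hi : i ∉ T) (hj : j ∉ T) :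
    koszulSign k i (insert j T) * koszulSign k j T =
      -(koszulSign k j (insert i T) * koszulSign k i T) := by
  unfold koszulSign
  rw [Finset.filter_insert, Finset.filter_insert]
  rcases lt_or_gt_of_ne hij with h | h
  · rw [if_neg h.not_gt, if_pos h, Finset.card_insert_of_notMem (by simp [hi])]
    ring
  · rw [if_pos h, if_neg h.not_gt, Finset.card_insert_of_notMem (by simp [hj])]
    ring

/-- The simplicial boundary on families of vectors indexed by the faces of a simplex. -/
def koszulBoundary (k : Type*) [Field k] (n : ℕ) (V : Type*) [AddCommGroup V] [Module k V] :
    (Finset (Fin n) → V) →ₗ[k] (Finset (Fin n) → V) :=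
  LinearMap.pi fun T => ∑ i ∈ Tᶜ, koszulSign k i T • LinearMap.proj (insert i T)

theorem koszulBoundary_apply (c : Finset (Fin n) → V) (T : Finset (Fin n)) :
    koszulBoundary k n V c T = ∑ i ∈ Tᶜ, koszulSign k i T • c (insert i T) := by
  simp [koszulBoundary, LinearMap.sum_apply]

theorem koszulBoundary_koszulBoundary (c : Finset (Fin n) → V) :
    koszulBoundary k n V (koszulBoundary k n V c) = 0 := by
  funext T
  simp only [koszulBoundary_apply, Finset.smul_sum, smul_smul, Pi.zero_apply]
  rw [Finset.sum_sigma']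
  -- Removing two vertices in either order gives opposite signs.
  refine Finset.sum_involution (fun p _ => ⟨p.2, p.1⟩) ?_ ?_ ?_ ?_
  · rintro ⟨i, j⟩ h
    simp only [Finset.mem_sigma, Finset.mem_compl, Finset.mem_insert, not_or] at h
    dsimp only
    rw [Finset.insert_comm i j, ← add_smul, mul_comm, koszulSign_insert_mul h.2.1 h.2.2 h.1]
    rw [mul_comm (koszulSign k j T)]
    simp
  · rintro ⟨i, j⟩ h _ h2
    simp only [Finset.mem_sigma, Finset.mem_compl, Finset.mem_insert, not_or] at h
    simp only [Sigma.mk.injEq, heq_eq_eq] at h2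
    exact h.2.1 h2.1
  · rintro ⟨i, j⟩ h
    simp only [Finset.mem_sigma, Finset.mem_compl, Finset.mem_insert, not_or] at h ⊢
    exact ⟨h.2.2, fun e => h.2.1 e.symm, h.1⟩
  · rintro ⟨i, j⟩ _
    rfl

/-- The cone with apex `v`, a contracting homotopy of the full simplex. -/
def koszulCone (v : Fin n) (c : Finset (Fin n) → V) (T : Finset (Fin n)) : V :=
  if v ∈ T then koszulSign k v (T.erase v) • c (T.erase v) else 0

theorem koszulBoundary_koszulCone (v : Fin n) (c : Finset (Fin n) → V) :
    koszulBoundary k n V (koszulCone (k := k) v c) +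
      koszulCone (k := k) v (koszulBoundary k n V c) = c := by
  funext T
  rw [Pi.add_apply, koszulBoundary_apply]
  by_cases hv : v ∈ T
  · have hv' : v ∉ T.erase v := by simp
    have hT : (T.erase v)ᶜ = insert v Tᶜ := by
      ext i; by_cases h : i = v <;> simp [h]
    rw [koszulCone, if_pos hv, koszulBoundary_apply, hT, Finset.sum_insert (by simp [hv]),
      Finset.insert_erase hv, smul_add, smul_smul, koszulSign_mul_self, one_smul, Finset.smul_sum,
      add_left_comm, ← Finset.sum_add_distrib]
    rw [Finset.sum_eq_zero, add_zero]
    intro i hi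
    have hi' : i ∉ T := by simpa using hi
    have hiv : i ≠ v := fun h => hi' (h ▸ hv)
    have e : (insert i T).erase v = insert i (T.erase v) :=
      Finset.erase_insert_of_ne hiv
    rw [koszulCone, if_pos (by simp [hv]), e, smul_smul, smul_smul, ← add_smul]
    have := koszulSign_insert_mul (k := k) hiv (T := T.erase v) (by simp [hi']) hv'
    rw [Finset.insert_erase hv] at this
    have h2 : koszulSign k i T * koszulSign k v (insert i (T.erase v)) +
        koszulSign k v (T.erase v) * koszulSign k i (T.erase v) = 0 := by
      have a1 := koszulSign_mul_self (k := k) v (T.erase v)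
      have a2 := koszulSign_mul_self (k := k) v (insert i (T.erase v))
      linear_combination koszulSign k v (insert i (T.erase v)) * koszulSign k v (T.erase v) * this
        - koszulSign k i T * koszulSign k v (insert i (T.erase v)) * a1
        - koszulSign k v (T.erase v) * koszulSign k i (T.erase v) * a2
    rw [h2, zero_smul]
  · rw [koszulCone, if_neg hv, add_zero, Finset.sum_eq_single v]
    · rw [koszulCone, if_pos (by simp), Finset.erase_insert hv, smul_smul, koszulSign_mul_self,
        one_smul]
    · intro i _ hi
      rw [koszulCone, if_neg (by simp [hv, hi.symm]), smul_zero]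
    · intro h
      simp [hv] at h

/-- The chains of homological degree `j` with the coefficient of a face `T` in `N T`. -/
def koszulChains (N : Finset (Fin n) → Submodule k V) (j : ℕ) :
    Submodule k (Finset (Fin n) → V) where
  carrier := {c | ∀ T, c T ∈ N T ∧ (T.card ≠ j → c T = 0)}
  add_mem' {a b} ha hb T :=
    ⟨add_mem (ha T).1 (hb T).1, fun h => by simp [(ha T).2 h, (hb T).2 h]⟩
  zero_mem' T := ⟨zero_mem _, fun _ => rfl⟩
  smul_mem' r a ha T := ⟨Submodule.smul_mem _ _ (ha T).1, fun h => by simp [(ha T).2 h]⟩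

theorem mem_koszulChains {N : Finset (Fin n) → Submodule k V} {j : ℕ}
    {c : Finset (Fin n) → V} :
    c ∈ koszulChains N j ↔ ∀ T, c T ∈ N T ∧ (T.card ≠ j → c T = 0) := Iff.rfl

theorem koszulChains_mono {N N' : Finset (Fin n) → Submodule k V} (h : ∀ T, N T ≤ N' T) (j : ℕ) :
    koszulChains N j ≤ koszulChains N' j := fun _ hc T => ⟨h T (hc T).1, (hc T).2⟩

theorem koszulBoundary_mem_koszulChains {N : Finset (Fin n) → Submodule k V}
    (hN : Antitone N) {j : ℕ} {c : Finset (Fin n) → V} (hc : c ∈ koszulChains N (j + 1)) :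
    koszulBoundary k n V c ∈ koszulChains N j := by
  intro T
  rw [koszulBoundary_apply]
  refine ⟨sum_mem fun i _ => Submodule.smul_mem _ _
    (hN (Finset.subset_insert i T) (hc (insert i T)).1), fun hT => Finset.sum_eq_zero fun i hi => ?_⟩
  rw [(hc (insert i T)).2, smul_zero]
  rw [Finset.card_insert_of_notMem (by simpa using hi)]
  omega

theorem koszulBoundary_eq_zero_of_mem_koszulChains_zero {N : Finset (Fin n) → Submodule k V}
    {c : Finset (Fin n) → V} (hc : c ∈ koszulChains N 0) : koszulBoundary k n V c = 0 := by
  funext T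
  rw [koszulBoundary_apply]
  refine Finset.sum_eq_zero fun i _ => ?_
  rw [(hc (insert i T)).2 (by simp), smul_zero]

theorem koszulBoundary_compLeft (f : V →ₗ[k] W) (c : Finset (Fin n) → V) :
    koszulBoundary k n W (f.compLeft _ c) = f.compLeft _ (koszulBoundary k n V c) := by
  funext T
  simp [koszulBoundary_apply, LinearMap.compLeft_apply, map_sum]

theorem compLeft_mem_koszulChains {f : V →ₗ[k] W} {N : Finset (Fin n) → Submodule k V} {j : ℕ}
    {c : Finset (Fin n) → V} (hc : c ∈ koszulChains N j) :
    f.compLeft _ c ∈ koszulChains (fun T => (N T).map f) j :=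
  fun T => ⟨Submodule.mem_map_of_mem (hc T).1, fun h => by
    rw [LinearMap.compLeft_apply, Function.comp_apply, (hc T).2 h, map_zero]⟩

/-- No compatibility between faces is required of a chain, so lifts may be chosen face by face. -/
theorem exists_compLeft_eq {f : V →ₗ[k] W} {N : Finset (Fin n) → Submodule k V} {j : ℕ}
    {c : Finset (Fin n) → W} (hc : c ∈ koszulChains (fun T => (N T).map f) j) :
    ∃ b ∈ koszulChains N j, f.compLeft _ b = c := by
  choose b hb hbc using fun T => Submodule.mem_map.1 (hc T).1
  refine ⟨fun T => if T.card = j then b T else 0, fun T => ?_, ?_⟩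
  · by_cases h : T.card = j <;> simp [h, hb]
  · funext T
    by_cases h : T.card = j
    · simp [h, hbc]
    · simp [h, (hc T).2 h]

/-! ### Homology and dimension shifting -/

/-- The homology of the chains with coefficients in the family `N`. -/
abbrev koszulHomology (N : Finset (Fin n) → Submodule k V) (j : ℕ) : Type _ :=
  ↥(koszulChains N j ⊓ LinearMap.ker (koszulBoundary k n V)) ⧸
    ((koszulChains N (j + 1)).map (koszulBoundary k n V)).submoduleOf
      (koszulChains N j ⊓ LinearMap.ker (koszulBoundary k n V))

theorem nonempty_quotient_equiv {L X : Type*} [AddCommGroup L] [Module k L] [AddCommGroup X]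
    [Module k X] (P : Submodule k L) (f : L →ₗ[k] X) {A : Submodule k X} (A' : Submodule k X)
    (hf : P.map f = A) :
    Nonempty ((P ⧸ (A'.comap f).submoduleOf P) ≃ₗ[k] (A ⧸ A'.submoduleOf A)) := by
  subst hf
  have hs : Function.Surjective (((A'.submoduleOf (P.map f)).mkQ).comp (f.submoduleMap P)) :=
    (Submodule.mkQ_surjective _).comp (f.submoduleMap_surjective P)
  refine ⟨(Submodule.quotEquivOfEq _ _ ?_).trans (LinearMap.quotKerEquivOfSurjective _ hs)⟩
  ext x
  rw [LinearMap.mem_ker, LinearMap.comp_apply, Submodule.mkQ_apply, Submodule.Quotient.mk_eq_zero]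
  rfl

/-- Both sides are the quotient of `P` by one and the same subspace. This gives connecting
isomorphisms without constructing a connecting map. -/
theorem nonempty_equiv_of_correspondence {L X Y : Type*} [AddCommGroup L] [Module k L]
    [AddCommGroup X] [Module k X] [AddCommGroup Y] [Module k Y] (P : Submodule k L)
    (f : L →ₗ[k] X) (g : L →ₗ[k] Y) {A A' : Submodule k X} {B B' : Submodule k Y}
    (hf : P.map f = A) (hg : P.map g = B) (h : ∀ c ∈ P, f c ∈ A' ↔ g c ∈ B') :
    Nonempty ((A ⧸ A'.submoduleOf A) ≃ₗ[k] (B ⧸ B'.submoduleOf B)) := by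
  obtain ⟨e⟩ := nonempty_quotient_equiv P f A' hf
  obtain ⟨e'⟩ := nonempty_quotient_equiv P g B' hg
  refine ⟨e.symm.trans ((Submodule.quotEquivOfEq _ _ ?_).trans e')⟩
  ext x
  simpa [Submodule.submoduleOf] using h x x.2

theorem nonempty_equiv_of_surjection {L X Y : Type*} [AddCommGroup L] [Module k L]
    [AddCommGroup X] [Module k X] [AddCommGroup Y] [Module k Y] (P : Submodule k L)
    (f : L →ₗ[k] X) (g : L →ₗ[k] Y) {A A' : Submodule k X}
    (hf : P.map f = A) (hg : P.map g = ⊤) (h : ∀ c ∈ P, f c ∈ A' ↔ g c = 0) :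
    Nonempty ((A ⧸ A'.submoduleOf A) ≃ₗ[k] Y) := by
  obtain ⟨e⟩ := nonempty_equiv_of_correspondence (B' := ⊥) P f g hf hg (by simpa using h)
  refine ⟨e.trans ((Submodule.quotEquivOfEqBot _ ?_).trans Submodule.topEquiv)⟩
  ext x
  simp [Submodule.submoduleOf]

/-- Dimension shifting along a family of surjections `F T → N T` whose source has no homology. -/
theorem nonempty_koszulHomology_shift (f : V →ₗ[k] W) (F Z : Finset (Fin n) → Submodule k V)
    (hF : Antitone F) (hZ : ∀ T, Z T = F T ⊓ LinearMap.ker f) (j : ℕ)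
    (hexZ : ∀ w ∈ koszulChains Z j, koszulBoundary k n V w = 0 →
      ∃ u ∈ koszulChains F (j + 1), koszulBoundary k n V u = w)
    (hexF : ∀ w ∈ koszulChains F (j + 1), koszulBoundary k n V w = 0 →
      ∃ u ∈ koszulChains F (j + 2), koszulBoundary k n V u = w) :
    Nonempty (koszulHomology (fun T => (F T).map f) (j + 1) ≃ₗ[k] koszulHomology Z j) := by
  have memZ : ∀ (i : ℕ) (c : Finset (Fin n) → V), c ∈ koszulChains Z i ↔
      c ∈ koszulChains F i ∧ f.compLeft _ c = 0 := by
    intro i c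
    simp only [mem_koszulChains, hZ, Submodule.mem_inf, LinearMap.mem_ker, funext_iff,
      LinearMap.compLeft_apply, Function.comp_apply, Pi.zero_apply]
    exact ⟨fun h => ⟨fun T => ⟨(h T).1.1, (h T).2⟩, fun T => (h T).1.2⟩,
      fun h T => ⟨⟨(h.1 T).1, h.2 T⟩, (h.1 T).2⟩⟩
  -- The snake: the common source is the space of `F`-chains whose image under `f` is a cycle,
  -- mapped to one side by `f` and to the other by the boundary.
  refine nonempty_equiv_of_correspondence
    (koszulChains F (j + 1) ⊓
      LinearMap.ker ((koszulBoundary k n W).comp (f.compLeft (Finset (Fin n)))))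
    (f.compLeft _) (koszulBoundary k n V) ?_ ?_ ?_
  · ext c
    constructor
    · rintro ⟨b, ⟨hb, hb'⟩, rfl⟩
      exact ⟨compLeft_mem_koszulChains hb, hb'⟩
    · rintro ⟨hc, hc'⟩
      obtain ⟨b, hb, rfl⟩ := exists_compLeft_eq hc
      exact ⟨b, ⟨hb, hc'⟩, rfl⟩
  · ext w
    constructor
    · rintro ⟨b, ⟨hb, hb'⟩, rfl⟩
      refine ⟨(memZ _ _).2 ⟨koszulBoundary_mem_koszulChains hF hb, ?_⟩,
        koszulBoundary_koszulBoundary b⟩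
      rw [← koszulBoundary_compLeft]
      exact hb'
    · rintro ⟨hw, hw'⟩
      obtain ⟨u, hu, rfl⟩ := hexZ w hw hw'
      refine ⟨u, ⟨hu, ?_⟩, rfl⟩
      change koszulBoundary k n W (f.compLeft _ u) = 0
      rw [koszulBoundary_compLeft]
      exact ((memZ _ _).1 hw).2
  · rintro c ⟨hc, -⟩
    constructor
    · rintro ⟨y, hy, hyc⟩
      obtain ⟨e, he, rfl⟩ := exists_compLeft_eq hy
      refine ⟨c - koszulBoundary k n V e, (memZ _ _).2 ⟨sub_mem hc
        (koszulBoundary_mem_koszulChains hF he), ?_⟩, ?_⟩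
      · rw [map_sub, ← koszulBoundary_compLeft, hyc, sub_self]
      · rw [map_sub, koszulBoundary_koszulBoundary, sub_zero]
    · rintro ⟨e, he, hec⟩
      obtain ⟨he, he'⟩ := (memZ _ _).1 he
      obtain ⟨u, hu, huc⟩ := hexF (c - e) (sub_mem hc he) (by rw [map_sub, hec, sub_self])
      refine ⟨f.compLeft _ u, compLeft_mem_koszulChains hu, ?_⟩
      rw [koszulBoundary_compLeft, huc, map_sub, he', sub_zero]

/-! ### Simplicial complexes with homology in top dimension -/

theorem koszulCone_eq_zero_of_card (v : Fin n) {N : Finset (Fin n) → Submodule k V} {j : ℕ}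
    {c : Finset (Fin n) → V} (hc : c ∈ koszulChains N j) {T : Finset (Fin n)}
    (hT : T.card ≠ j + 1) : koszulCone (k := k) v c T = 0 := by
  unfold koszulCone
  split_ifs with h
  · rw [(hc _).2, smul_zero]
    rw [Finset.card_erase_of_mem h]
    have := Finset.card_pos.2 ⟨v, h⟩
    omega
  · rfl

theorem koszulBoundary_koszulCone_of_cycle (v : Fin n) {c : Finset (Fin n) → V}
    (hc : koszulBoundary k n V c = 0) :
    koszulBoundary k n V (koszulCone (k := k) v c) = c := by
  have := koszulBoundary_koszulCone (k := k) v c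
  rw [hc] at this
  have h0 : koszulCone (k := k) v (0 : Finset (Fin n) → V) = 0 := by
    funext T; simp [koszulCone]
  rwa [h0, add_zero] at this

open Classical in
/-- The coefficient family of a simplicial complex `A`. -/
noncomputable def complexFamily (k V : Type*) [Field k] [AddCommGroup V] [Module k V] {n : ℕ}
    (A : Finset (Fin n) → Prop) (T : Finset (Fin n)) : Submodule k V :=
  if A T then ⊤ else ⊥

theorem koszulCone_mem_complexFamily (v : Fin n) {N : Finset (Fin n) → Submodule k V}
    {A : Finset (Fin n) → Prop} {j : ℕ} (hA : ∀ T, T.card = j + 1 → A T)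
    {c : Finset (Fin n) → V} (hc : c ∈ koszulChains N j) :
    koszulCone (k := k) v c ∈ koszulChains (complexFamily k V A) (j + 1) := by
  refine fun T => ⟨?_, koszulCone_eq_zero_of_card v hc⟩
  by_cases h : T.card = j + 1
  · simp [complexFamily, hA T h]
  · rw [koszulCone_eq_zero_of_card v hc h]
    exact zero_mem _

/-- If the full simplex lay in `A`, coning would bound every cycle. If the facet opposite `i` were
missing, a cycle `w` would vanish on it, so its cone from `i`, which lives only on the full face,
would be zero, and `w` with it. -/
theorem eq_univ_iff_of_nontrivial {A : Finset (Fin n) → Prop}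
    (hA : ∀ S T, S ⊆ T → A T → A S) {j : ℕ} (hj : j + 1 = n)
    (h : Nontrivial (koszulHomology (complexFamily k V A) j)) (T : Finset (Fin n)) :
    A T ↔ T ≠ Finset.univ := by
  obtain ⟨w, hw, hw', hwn⟩ : ∃ w ∈ koszulChains (complexFamily k V A) j,
      koszulBoundary k n V w = 0 ∧
      w ∉ (koszulChains (complexFamily k V A) (j + 1)).map (koszulBoundary k n V) := by
    by_contra! hcon
    rw [Submodule.Quotient.nontrivial_iff] at h
    refine h (eq_top_iff.2 ?_)
    rintro ⟨w, hw, hw'⟩ -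
    exact hcon w hw hw'
  have huniv : ¬ A Finset.univ := fun hu => by
    have v : Fin n := ⟨0, by omega⟩
    exact hwn ⟨_, koszulCone_mem_complexFamily v (fun T _ => hA _ _ (Finset.subset_univ T) hu) hw,
      koszulBoundary_koszulCone_of_cycle v hw'⟩
  have hface : ∀ i : Fin n, A (Finset.univ.erase i) := by
    intro i
    by_contra hi
    apply hwn
    have hz : koszulCone (k := k) i w = 0 := by
      funext T
      by_cases hT : T.card = j + 1
      · have : T = Finset.univ := by
          rw [← Finset.card_eq_iff_eq_univ, Fintype.card_fin]; omega
        subst this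
        have h0 := (hw (Finset.univ.erase i)).1
        rw [complexFamily, if_neg hi, Submodule.mem_bot] at h0
        simp [koszulCone, h0]
      · exact koszulCone_eq_zero_of_card i hw hT
    have := koszulBoundary_koszulCone_of_cycle i hw'
    rw [hz, map_zero] at this
    rw [← this]
    exact zero_mem _
  constructor
  · rintro h rfl
    exact huniv h
  · intro hT
    obtain ⟨i, hi⟩ : ∃ i, i ∉ T := by
      by_contra! hcon
      exact hT (Finset.eq_univ_iff_forall.2 hcon)
    refine hA _ _ (fun x hx => ?_) (hface i)
    simp only [Finset.mem_erase, Finset.mem_univ, and_true]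
    rintro rfl
    exact hi hx

theorem subsingleton_koszulHomology {A : Finset (Fin n) → Prop}
    (hA : ∀ T, A T ↔ T ≠ Finset.univ) {j : ℕ} (hj : j + 1 ≠ n) :
    Subsingleton (koszulHomology (complexFamily k V A) j) := by
  rw [Submodule.Quotient.subsingleton_iff, eq_top_iff]
  rintro ⟨w, hw, hw'⟩ -
  change w ∈ (koszulChains _ (j + 1)).map (koszulBoundary k n V)
  have hcard : ∀ T : Finset (Fin n), T.card ≠ n ↔ T ≠ Finset.univ := by
    intro T
    rw [Ne, Ne, ← Finset.card_eq_iff_eq_univ, Fintype.card_fin]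
  -- Below the top, all faces of `j + 1` vertices are present and cones are allowed; for `j ≥ n`
  -- there are no faces of `j` vertices in `A`.
  by_cases hn : j + 1 < n
  · have v : Fin n := ⟨0, by omega⟩
    exact ⟨_, koszulCone_mem_complexFamily v (fun T hT => (hA T).2 ((hcard T).1 (by omega))) hw,
      koszulBoundary_koszulCone_of_cycle v hw'⟩
  · have : w = 0 := by
      funext T
      by_cases hT : T = Finset.univ
      · have h0 := (hw T).1
        rwa [complexFamily, if_neg (by simp [hA, hT]), Submodule.mem_bot] at h0
      · have h1 := (hcard T).2 hT
        have h2 : T.card ≤ n := by simpa using T.card_le_univ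
        exact (hw T).2 (by omega)
    rw [this]
    exact zero_mem _

theorem nonempty_koszulHomology_equiv {A : Finset (Fin n) → Prop}
    (hA : ∀ T, A T ↔ T ≠ Finset.univ) {j : ℕ} (hj : j + 1 = n) :
    Nonempty (koszulHomology (complexFamily k V A) j ≃ₗ[k] V) := by
  have hcard : ∀ T : Finset (Fin n), T.card = j + 1 ↔ T = Finset.univ := by
    intro T
    rw [← Finset.card_eq_iff_eq_univ, Fintype.card_fin, hj]
  have v : Fin n := ⟨0, by omega⟩
  have hmem : ∀ x : V, Pi.single Finset.univ x ∈
      koszulChains (fun _ : Finset (Fin n) => (⊤ : Submodule k V)) (j + 1) := by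
    refine fun x T => ⟨trivial, fun hT => ?_⟩
    rw [Ne, hcard] at hT
    simp [hT]
  -- Each cycle is the boundary of the missing top face with a unique coefficient, recovered by
  -- coning.
  refine nonempty_equiv_of_surjection ⊤
    ((koszulBoundary k n V).comp (LinearMap.single k (fun _ => V) Finset.univ)) LinearMap.id
    ?_ (by simp) ?_
  · ext w
    constructor
    · rintro ⟨x, -, rfl⟩
      refine ⟨fun T => ?_, koszulBoundary_koszulBoundary _⟩
      have h1 := koszulBoundary_mem_koszulChains (fun _ _ _ => le_rfl) (hmem x) T
      refine ⟨?_, h1.2⟩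
      by_cases hT : T = Finset.univ
      · have : T.card ≠ j := by rw [(hcard T).2 hT]; omega
        rw [LinearMap.comp_apply, LinearMap.single_apply, h1.2 this]
        exact zero_mem _
      · rw [complexFamily, if_pos ((hA T).2 hT)]
        trivial
    · rintro ⟨hw, hw'⟩
      refine ⟨koszulCone (k := k) v w Finset.univ, trivial, ?_⟩
      rw [LinearMap.comp_apply, LinearMap.single_apply]
      conv_rhs => rw [← koszulBoundary_koszulCone_of_cycle v hw']
      congr 1
      funext T
      by_cases hT : T = Finset.univ
      · subst hT; simp
      · rw [Pi.single_eq_of_ne hT, koszulCone_eq_zero_of_card v hw (by rwa [Ne, hcard])]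
  · intro x _
    rw [LinearMap.id_apply]
    constructor
    · rintro ⟨y, hy, hyx⟩
      have hy0 : y = 0 := by
        funext T
        by_cases hT : T = Finset.univ
        · have h0 := (hy T).1
          rwa [complexFamily, if_neg (by simp [hA, hT]), Submodule.mem_bot] at h0
        · exact (hy T).2 (by rwa [Ne, hcard])
      rw [hy0, map_zero] at hyx
      have h0 := congrFun hyx.symm (Finset.univ.erase v)
      rw [LinearMap.comp_apply, LinearMap.single_apply, koszulBoundary_apply, Finset.compl_erase]
        at h0
      simp only [Finset.compl_univ, insert_empty_eq, Finset.sum_singleton, Finset.insert_erase,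
        Finset.mem_univ, Pi.single_eq_same, Pi.zero_apply] at h0
      have := congrArg (koszulSign k v (Finset.univ.erase v) • ·) h0
      simpa [smul_smul, koszulSign_mul_self] using this
    · rintro rfl
      rw [map_zero]
      exact zero_mem _

end Koszul

/-! ### Strands of a resolution with the variables set to 1 -/

section Frame

open MvPolynomial

variable {k : Type u} [Field k] {n : ℕ} {M : Ideal (MvPolynomial (Fin n) k)}

theorem monomial_mul_right_cancel {a b : MvPolynomial (Fin n) k} {m : Fin n →₀ ℕ}
    (h : a * monomial m 1 = b * monomial m 1) : a = b :=
  mul_right_cancel₀ (by simp [monomial_eq_zero]) h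

namespace FreeResolution

variable (F : FreeResolution M)

/-- The scalar of the matrix entry of the differential from `σ` to `τ`. -/
noncomputable def entry (i : ℕ) (σ : F.B (i + 1)) (τ : F.B i) : k :=
  eval 1 (F.d i (Finsupp.single σ 1) τ)

theorem d_single_mul (i : ℕ) (σ : F.B (i + 1)) (τ : F.B i) :
    F.d i (Finsupp.single σ 1) τ * monomial (F.mdeg i τ) 1 =
      monomial (F.mdeg (i + 1) σ) (F.entry i σ τ) := by
  obtain ⟨c, hc⟩ := F.d_homogeneous i σ τ
  have := congrArg (eval (1 : Fin n → k)) hc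
  simp only [map_mul, eval_monomial, Pi.one_apply, one_pow, Finsupp.prod_fun_one, mul_one] at this
  rw [hc, entry, this]

theorem mdeg_le_of_entry_ne_zero {i : ℕ} {σ : F.B (i + 1)} {τ : F.B i}
    (h : F.entry i σ τ ≠ 0) : F.mdeg i τ ≤ F.mdeg (i + 1) σ := by
  by_contra hle
  have := congrArg (coeff (F.mdeg (i + 1) σ)) (F.d_single_mul i σ τ)
  rw [coeff_mul_monomial', if_neg hle, coeff_monomial, if_pos rfl] at this
  exact h this.symm

/-- Between equal multidegrees a matrix entry is a constant, hence a unit if nonzero. -/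
theorem mdeg_ne_of_entry_ne_zero (hF : F.IsMinimal) {i : ℕ} {σ : F.B (i + 1)} {τ : F.B i}
    (h : F.entry i σ τ ≠ 0) : F.mdeg i τ ≠ F.mdeg (i + 1) σ := by
  intro he
  apply hF i σ τ
  have h1 := F.d_single_mul i σ τ
  have h2 : F.d i (Finsupp.single σ 1) τ = C (F.entry i σ τ) := by
    apply monomial_mul_right_cancel (m := F.mdeg i τ)
    rw [h1, C_mul_monomial, mul_one, he]
  rw [h2]
  exact (isUnit_iff_ne_zero.2 h).map C

/-- The differential with all variables specialised to `1`. -/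
noncomputable def frame (i : ℕ) : (F.B (i + 1) →₀ k) →ₗ[k] (F.B i →₀ k) :=
  Finsupp.linearCombination k fun σ =>
    (F.d i (Finsupp.single σ 1)).mapRange (eval 1) (map_zero _)

theorem frame_apply (i : ℕ) (f : F.B (i + 1) →₀ k) (τ : F.B i) :
    F.frame i f τ = f.sum fun σ r => r * F.entry i σ τ := by
  rw [frame, Finsupp.linearCombination_apply, Finsupp.sum_apply]
  rfl

theorem d_apply (i : ℕ) (g : F.B (i + 1) →₀ MvPolynomial (Fin n) k) (τ : F.B i) :
    F.d i g τ = g.sum fun σ r => r * F.d i (Finsupp.single σ 1) τ := by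
  conv_lhs => rw [← Finsupp.sum_single g]
  rw [map_finsuppSum, Finsupp.sum_apply]
  refine Finsupp.sum_congr fun σ _ => ?_
  rw [← mul_one (g σ), ← smul_eq_mul, ← Finsupp.smul_single, map_smul]
  simp

theorem d_apply_mul (i : ℕ) (g : F.B (i + 1) →₀ MvPolynomial (Fin n) k) (τ : F.B i) :
    F.d i g τ * monomial (F.mdeg i τ) 1 =
      g.sum fun σ r => r * monomial (F.mdeg (i + 1) σ) (F.entry i σ τ) := by
  rw [d_apply, Finsupp.sum_mul]
  refine Finsupp.sum_congr fun σ _ => ?_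
  rw [mul_assoc, d_single_mul]

/-- The component of multidegree `a`, with all variables specialised to `1`. -/
noncomputable def strandCoeff (i : ℕ) (a : Fin n →₀ ℕ) (g : F.B i →₀ MvPolynomial (Fin n) k) :
    F.B i →₀ k :=
  Finsupp.onFinset g.support (fun τ => coeff a (g τ * monomial (F.mdeg i τ) 1)) fun τ h => by
    rw [Finsupp.mem_support_iff]
    rintro h0
    simp [h0] at h

theorem strandCoeff_apply (i : ℕ) (a : Fin n →₀ ℕ) (g : F.B i →₀ MvPolynomial (Fin n) k)
    (τ : F.B i) : F.strandCoeff i a g τ = coeff a (g τ * monomial (F.mdeg i τ) 1) := rfl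

theorem strandCoeff_d (i : ℕ) (a : Fin n →₀ ℕ) (g : F.B (i + 1) →₀ MvPolynomial (Fin n) k) :
    F.strandCoeff i a (F.d i g) = F.frame i (F.strandCoeff (i + 1) a g) := by
  ext τ
  rw [strandCoeff_apply, d_apply_mul, frame_apply, strandCoeff, Finsupp.onFinset_sum _ (by simp),
    Finsupp.sum, coeff_sum]
  refine Finset.sum_congr rfl fun σ _ => ?_
  rw [mul_comm (coeff _ _), ← coeff_C_mul, mul_left_comm, C_mul_monomial, mul_one]

/-- The span of the basis elements whose multidegree divides `a`. -/
noncomputable def strand (i : ℕ) (a : Fin n →₀ ℕ) : Submodule k (F.B i →₀ k) :=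
  Finsupp.supported k k {σ | F.mdeg i σ ≤ a}

theorem mem_strand {i : ℕ} {a : Fin n →₀ ℕ} {f : F.B i →₀ k} :
    f ∈ F.strand i a ↔ ∀ σ, f σ ≠ 0 → F.mdeg i σ ≤ a := by
  simp [strand, Finsupp.mem_supported, Set.subset_def]

theorem strandCoeff_mem_strand (i : ℕ) (a : Fin n →₀ ℕ) (g : F.B i →₀ MvPolynomial (Fin n) k) :
    F.strandCoeff i a g ∈ F.strand i a := by
  rw [mem_strand]
  intro σ h
  by_contra hle
  rw [strandCoeff_apply, coeff_mul_monomial', if_neg hle] at h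
  exact h rfl

theorem frame_mem_strand {i : ℕ} {a : Fin n →₀ ℕ} {f : F.B (i + 1) →₀ k}
    (hf : f ∈ F.strand (i + 1) a) : F.frame i f ∈ F.strand i a := by
  rw [mem_strand] at hf ⊢
  intro τ h
  rw [frame_apply] at h
  obtain ⟨σ, _, hσ⟩ := Finset.exists_ne_zero_of_sum_ne_zero h
  exact (F.mdeg_le_of_entry_ne_zero (right_ne_zero_of_mul hσ)).trans
    (hf σ (left_ne_zero_of_mul hσ))

/-- The homogeneous element of multidegree `a` with the given coefficients. -/
noncomputable def homogenize (i : ℕ) (a : Fin n →₀ ℕ) (f : F.B i →₀ k) :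
    F.B i →₀ MvPolynomial (Fin n) k :=
  Finsupp.onFinset f.support (fun τ => monomial (a - F.mdeg i τ) (f τ)) fun τ h => by
    rw [Finsupp.mem_support_iff]
    rintro h0
    simp [h0] at h

theorem homogenize_mul {i : ℕ} {a : Fin n →₀ ℕ} {f : F.B i →₀ k} (hf : f ∈ F.strand i a)
    (τ : F.B i) (c : k) :
    F.homogenize i a f τ * monomial (F.mdeg i τ) c = monomial a (f τ * c) := by
  change monomial (a - F.mdeg i τ) (f τ) * _ = _
  by_cases h : f τ = 0
  · simp [h]
  · rw [monomial_mul, tsub_add_cancel_of_le (F.mem_strand.1 hf τ h)]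

theorem strandCoeff_homogenize {i : ℕ} {a : Fin n →₀ ℕ} {f : F.B i →₀ k}
    (hf : f ∈ F.strand i a) : F.strandCoeff i a (F.homogenize i a f) = f := by
  ext τ
  rw [strandCoeff_apply, F.homogenize_mul hf, coeff_monomial, if_pos rfl, mul_one]

theorem d_homogenize {i : ℕ} {a : Fin n →₀ ℕ} {f : F.B (i + 1) →₀ k}
    (hf : f ∈ F.strand (i + 1) a) :
    F.d i (F.homogenize (i + 1) a f) = F.homogenize i a (F.frame i f) := by
  ext1 τ
  apply monomial_mul_right_cancel (m := F.mdeg i τ)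
  rw [F.homogenize_mul (F.frame_mem_strand hf), d_apply_mul, mul_one, frame_apply, homogenize,
    Finsupp.onFinset_sum _ (by simp), Finsupp.sum, map_sum]
  exact Finset.sum_congr rfl fun σ _ => F.homogenize_mul hf σ _

theorem homogenize_zero (i : ℕ) (a : Fin n →₀ ℕ) : F.homogenize i a 0 = 0 := by
  ext1 τ
  simp [homogenize]

/-- The preimage `g` need not be homogeneous; its component of multidegree `a` already does the job.
Exactness thus passes to strands. -/
theorem exists_frame_eq_of_d_eq {i : ℕ} {a : Fin n →₀ ℕ} {f : F.B i →₀ k}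
    (hf : f ∈ F.strand i a) (h : ∃ g, F.d i g = F.homogenize i a f) :
    ∃ g ∈ F.strand (i + 1) a, F.frame i g = f := by
  obtain ⟨g, hg⟩ := h
  exact ⟨_, F.strandCoeff_mem_strand _ a g, by rw [← strandCoeff_d, hg, F.strandCoeff_homogenize hf]⟩

theorem exists_frame_eq {i : ℕ} {a : Fin n →₀ ℕ} {f : F.B (i + 1) →₀ k}
    (hf : f ∈ F.strand (i + 1) a) (h : F.frame i f = 0) :
    ∃ g ∈ F.strand (i + 2) a, F.frame (i + 1) g = f :=
  F.exists_frame_eq_of_d_eq hf ((F.exact_succ i _).1 (by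
    rw [F.d_homogenize hf, h, homogenize_zero]))

theorem frame_frame {i : ℕ} {a : Fin n →₀ ℕ} {f : F.B (i + 2) →₀ k}
    (hf : f ∈ F.strand (i + 2) a) : F.frame i (F.frame (i + 1) f) = 0 := by
  have h := (F.exact_succ i (F.d (i + 1) (F.homogenize (i + 2) a f))).2 ⟨_, rfl⟩
  rw [F.d_homogenize hf, F.d_homogenize (F.frame_mem_strand hf)] at h
  rw [← F.strandCoeff_homogenize (F.frame_mem_strand (F.frame_mem_strand hf)), h]
  ext τ
  simp [strandCoeff_apply]

/-- A source `σ` with `mdeg σ ≤ a` reaching a target of multidegree `a` must itself have multidegree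
`a`, which minimality forbids. -/
theorem frame_apply_eq_zero (hF : F.IsMinimal) {i : ℕ} {a : Fin n →₀ ℕ} {f : F.B (i + 1) →₀ k}
    (hf : f ∈ F.strand (i + 1) a) {τ : F.B i} (hτ : F.mdeg i τ = a) : F.frame i f τ = 0 := by
  by_contra h
  rw [frame_apply] at h
  obtain ⟨σ, _, hσ⟩ := Finset.exists_ne_zero_of_sum_ne_zero h
  have h1 := right_ne_zero_of_mul hσ
  refine F.mdeg_ne_of_entry_ne_zero hF h1 (le_antisymm (F.mdeg_le_of_entry_ne_zero h1) ?_)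
  rw [hτ]
  exact F.mem_strand.1 hf σ (left_ne_zero_of_mul hσ)

theorem single_mem_strand {i : ℕ} {a : Fin n →₀ ℕ} {σ : F.B i} (h : F.mdeg i σ ≤ a) (c : k) :
    Finsupp.single σ c ∈ F.strand i a :=
  Finsupp.single_mem_supported k c h

/-- When the preceding module is zero, every basis element is a cycle, hence a boundary in its own
multidegree, against minimality. -/
theorem isEmpty_of_eq_top (hF : F.IsMinimal) (hM : M = ⊤) (i : ℕ) : IsEmpty (F.B i) := by
  subst hM
  have key : ∀ {i : ℕ} (σ : F.B i), ¬ ∃ g ∈ F.strand (i + 1) (F.mdeg i σ),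
      F.frame i g = Finsupp.single σ 1 := by
    rintro i σ ⟨g, hg, h⟩
    have := F.frame_apply_eq_zero hF hg rfl
    simp [h] at this
  induction i with
  | zero =>
    have : Subsingleton (MvPolynomial (Fin n) k ⧸ (⊤ : Ideal (MvPolynomial (Fin n) k))) :=
      Ideal.Quotient.subsingleton_iff.2 rfl
    exact ⟨fun σ => key σ (F.exists_frame_eq_of_d_eq (F.single_mem_strand le_rfl 1)
      ((F.exact_zero _).1 (Subsingleton.elim _ _)))⟩
  | succ i ih =>
    exact ⟨fun σ => key σ (F.exists_frame_eq (F.single_mem_strand le_rfl 1)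
      (Subsingleton.elim _ _))⟩

end FreeResolution

theorem constantCoeff_eq_zero_of_mem (hM : IsMonomialIdeal M) (hM' : M ≠ ⊤)
    {p : MvPolynomial (Fin n) k} (hp : p ∈ M) : constantCoeff p = 0 := by
  obtain ⟨G, rfl⟩ := hM
  have : Ideal.span ((fun a => monomial a (1 : k)) '' G) ≤
      RingHom.ker (constantCoeff (σ := Fin n) (R := k)) := by
    rw [Ideal.span_le]
    rintro _ ⟨a, ha, rfl⟩
    rw [SetLike.mem_coe, RingHom.mem_ker]
    by_cases h0 : a = 0
    · refine absurd ((Ideal.eq_top_iff_one _).2 ?_) hM'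
      exact Ideal.subset_span ⟨a, ha, by subst h0; rfl⟩
    · simp [constantCoeff_monomial, h0]
  exact this hp

theorem monomial_mem_iff {a : Fin n →₀ ℕ} {c : k} :
    monomial a c ∈ M ↔ c = 0 ∨ monomial a 1 ∈ M := by
  by_cases hc : c = 0
  · simp [hc]
  · simp only [hc, false_or]
    have h1 : monomial a c = C c * monomial a (1 : k) := by rw [C_mul_monomial, mul_one]
    rw [h1]
    exact Ideal.unit_mul_mem_iff_mem M ((isUnit_iff_ne_zero.2 hc).map C)

theorem FreeResolution.exists_unique_generator (F : FreeResolution M) (hF : F.IsMinimal)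
    (hM : IsMonomialIdeal M) (hM' : M ≠ ⊤) :
    ∃ σ₀ : F.B 0, (∀ σ, σ = σ₀) ∧ F.mdeg 0 σ₀ = 0 ∧ ∀ (a : Fin n →₀ ℕ) (f : F.B 0 →₀ k),
      (∃ g ∈ F.strand 1 a, F.frame 0 g = f) ↔ f = 0 ∨ monomial a 1 ∈ M := by
  choose c hc using F.aug_homogeneous
  have haug : ∀ g, F.aug g =
      Ideal.Quotient.mk M (g.sum fun σ r => r * monomial (F.mdeg 0 σ) (c σ)) := by
    intro g
    conv_lhs => rw [← Finsupp.sum_single g]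
    rw [map_finsuppSum, map_finsuppSum]
    refine Finsupp.sum_congr fun σ _ => ?_
    rw [← mul_one (g σ), ← smul_eq_mul, ← Finsupp.smul_single, map_smul, hc, smul_eq_mul, mul_one,
      map_mul]
    rfl
  have haugh : ∀ (a : Fin n →₀ ℕ) (f : F.B 0 →₀ k), f ∈ F.strand 0 a →
      (F.aug (F.homogenize 0 a f) = 0 ↔ monomial a (f.sum fun σ r => r * c σ) ∈ M) := by
    intro a f hf
    rw [haug, Ideal.Quotient.eq_zero_iff_mem, homogenize, Finsupp.onFinset_sum _ (by simp),
      Finsupp.sum, map_sum]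
    rw [← Finset.sum_congr rfl fun σ _ => F.homogenize_mul hf σ (c σ)]
    rfl
  have hex : ∀ (a : Fin n →₀ ℕ) (f : F.B 0 →₀ k), f ∈ F.strand 0 a →
      ((∃ g ∈ F.strand 1 a, F.frame 0 g = f) ↔
        (f.sum fun σ r => r * c σ) = 0 ∨ monomial a 1 ∈ M) := by
    intro a f hf
    rw [← monomial_mem_iff, ← haugh a f hf]
    constructor
    · rintro ⟨g, hg, rfl⟩
      rw [← F.d_homogenize hg]
      exact (F.exact_zero _).2 ⟨_, rfl⟩
    · intro h
      exact F.exists_frame_eq_of_d_eq hf ((F.exact_zero _).1 h)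
  -- Otherwise a lift of 1 in the image of the augmentation would have no constant term modulo `M`.
  obtain ⟨σ₀, hσ₀, hcσ₀⟩ : ∃ σ₀, F.mdeg 0 σ₀ = 0 ∧ c σ₀ ≠ 0 := by
    by_contra! hcon
    obtain ⟨g, hg⟩ := F.aug_surjective 1
    rw [haug, ← map_one (Ideal.Quotient.mk M), Ideal.Quotient.mk_eq_mk_iff_sub_mem] at hg
    have := constantCoeff_eq_zero_of_mem hM hM' hg
    rw [map_sub, map_one, map_finsuppSum, Finsupp.sum, Finset.sum_eq_zero] at this
    · simp at this
    · intro σ _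
      by_cases h0 : F.mdeg 0 σ = 0
      · simp [hcon σ h0]
      · simp [constantCoeff_monomial, h0]
  have huniq : ∀ σ, σ = σ₀ := by
    intro σ
    by_contra hne
    -- The augmentation kills this relation, so it is a boundary whose coefficient at `σ` is `c σ₀ ≠
    -- 0`, against minimality.
    have hmem : Finsupp.single σ (c σ₀) - Finsupp.single σ₀ (c σ) ∈ F.strand 0 (F.mdeg 0 σ) :=
      sub_mem (F.single_mem_strand le_rfl _) (F.single_mem_strand (by simp [hσ₀]) _)
    obtain ⟨g, hg, h⟩ := (hex _ _ hmem).2 (Or.inl (by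
      rw [Finsupp.sum_sub_index (by intros; ring), Finsupp.sum_single_index (by simp),
        Finsupp.sum_single_index (by simp)]
      ring))
    have := F.frame_apply_eq_zero hF hg (τ := σ) rfl
    rw [h, Finsupp.sub_apply, Finsupp.single_eq_same, Finsupp.single_eq_of_ne hne, sub_zero] at this
    exact hcσ₀ this
  refine ⟨σ₀, huniq, hσ₀, fun a f => ?_⟩
  have hf : f = Finsupp.single σ₀ (f σ₀) := by
    ext σ
    rw [huniq σ, Finsupp.single_eq_same]
  rw [hex a f (F.mem_strand.2 fun σ _ => by simp [huniq σ, hσ₀]), hf,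
    Finsupp.sum_single_index (by simp)]
  simp [hcσ₀]

end Frame

/-! ### Multigraded Betti numbers from the upper Koszul complex -/

section Betti

open MvPolynomial

variable {k : Type u} [Field k] {n : ℕ} {M : Ideal (MvPolynomial (Fin n) k)}

/-- The exponent vector of the squarefree monomial with support `T`. -/
noncomputable def squarefreeExponent {n : ℕ} (T : Finset (Fin n)) : Fin n →₀ ℕ :=
  Finsupp.indicator T fun _ _ => 1

theorem squarefreeExponent_apply (T : Finset (Fin n)) (i : Fin n) :
    squarefreeExponent T i = if i ∈ T then 1 else 0 := by
  simp [squarefreeExponent, Finsupp.indicator_apply]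

theorem squarefreeExponent_mono : Monotone (squarefreeExponent (n := n)) := by
  intro S T h i
  rw [squarefreeExponent_apply, squarefreeExponent_apply]
  by_cases hi : i ∈ S
  · simp [hi, h hi]
  · simp [hi]

/-- The faces `T` such that `x^l / x^T` is a monomial of `M`. -/
def upperKoszul (M : Ideal (MvPolynomial (Fin n) k)) (l : Fin n →₀ ℕ) (T : Finset (Fin n)) : Prop :=
  squarefreeExponent T ≤ l ∧ monomial (l - squarefreeExponent T) 1 ∈ M

theorem upperKoszul_subset {l : Fin n →₀ ℕ} {S T : Finset (Fin n)} (h : S ⊆ T)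
    (hT : upperKoszul M l T) : upperKoszul M l S := by
  have hle := squarefreeExponent_mono h
  refine ⟨hle.trans hT.1, ?_⟩
  have : (monomial (l - squarefreeExponent S) (1 : k)) =
      monomial (squarefreeExponent T - squarefreeExponent S) 1 *
        monomial (l - squarefreeExponent T) 1 := by
    rw [monomial_mul, mul_one, add_comm, tsub_add_tsub_cancel hT.1 hle]
  rw [this]
  exact M.mul_mem_left _ hT.2

namespace FreeResolution

variable (F : FreeResolution M) (l : Fin n →₀ ℕ)

/-- The strand of multidegree `l - T`. -/
noncomputable def faceStrand (i : ℕ) (T : Finset (Fin n)) : Submodule k (F.B i →₀ k) :=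
  Finsupp.supported k k {σ | F.mdeg i σ + squarefreeExponent T ≤ l}

/-- The strand of multidegree `l - T` of the image of the differential. -/
noncomputable def faceSyzygy (i : ℕ) (T : Finset (Fin n)) : Submodule k (F.B i →₀ k) :=
  (F.faceStrand l (i + 1) T).map (F.frame i)

variable {l}

theorem mem_faceStrand {i : ℕ} {T : Finset (Fin n)} {f : F.B i →₀ k} :
    f ∈ F.faceStrand l i T ↔ ∀ σ, f σ ≠ 0 → F.mdeg i σ + squarefreeExponent T ≤ l := by
  simp [faceStrand, Finsupp.mem_supported, Set.subset_def]

theorem antitone_faceStrand (i : ℕ) : Antitone (F.faceStrand l i) := by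
  intro S T h f hf
  rw [mem_faceStrand] at hf ⊢
  exact fun σ hσ => (add_le_add_right (squarefreeExponent_mono h) _).trans (hf σ hσ)

theorem faceStrand_eq_strand {T : Finset (Fin n)} (hT : squarefreeExponent T ≤ l) (i : ℕ) :
    F.faceStrand l i T = F.strand i (l - squarefreeExponent T) := by
  ext f
  simp only [mem_faceStrand, mem_strand, le_tsub_iff_right hT]

theorem faceStrand_eq_bot {T : Finset (Fin n)} (hT : ¬ squarefreeExponent T ≤ l) (i : ℕ) :
    F.faceStrand l i T = ⊥ := by
  rw [eq_bot_iff]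
  intro f hf
  rw [mem_faceStrand] at hf
  ext σ
  by_contra h
  exact hT (le_add_self.trans (hf σ h))

theorem faceSyzygy_succ (i : ℕ) (T : Finset (Fin n)) :
    F.faceSyzygy l (i + 1) T = F.faceStrand l (i + 1) T ⊓ LinearMap.ker (F.frame i) := by
  unfold faceSyzygy
  by_cases hT : squarefreeExponent T ≤ l
  · rw [F.faceStrand_eq_strand hT, F.faceStrand_eq_strand hT]
    ext f
    constructor
    · rintro ⟨g, hg, rfl⟩
      exact ⟨F.frame_mem_strand hg, F.frame_frame hg⟩
    · rintro ⟨hf, hf'⟩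
      exact F.exists_frame_eq hf hf'
  · simp [F.faceStrand_eq_bot hT]

theorem apply_eq_zero_of_mem_faceSyzygy (hF : F.IsMinimal) {i : ℕ} {T : Finset (Fin n)}
    {f : F.B i →₀ k} (hf : f ∈ F.faceSyzygy l i T) {σ : F.B i} (hσ : F.mdeg i σ = l) :
    f σ = 0 := by
  obtain ⟨g, hg, rfl⟩ := hf
  refine F.frame_apply_eq_zero hF (F.mem_strand.2 fun τ hτ => ?_) hσ
  exact le_self_add.trans (F.mem_faceStrand.1 hg τ hτ)

/-- The strands of a free module have no homology away from the basis elements of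
multidegree `l`. -/
theorem exists_koszulBoundary_eq (i j : ℕ) {w : Finset (Fin n) → F.B i →₀ k}
    (hw : w ∈ koszulChains (F.faceStrand l i) j) (hw' : koszulBoundary k n _ w = 0)
    (hl : ∀ T σ, F.mdeg i σ = l → w T σ = 0) :
    ∃ u ∈ koszulChains (F.faceStrand l i) (j + 1), koszulBoundary k n _ u = w := by
  classical
  -- Each generator gets as cone apex a variable in which it lies strictly below `l`; `p x` keeps
  -- the generators with apex `x`.
  let v : F.B i → Option (Fin n) := fun σ =>
    if h : ∃ x, F.mdeg i σ x < l x then some h.choose else none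
  have hv : ∀ σ x, v σ = some x → F.mdeg i σ x < l x := by
    intro σ x h
    by_cases he : ∃ x, F.mdeg i σ x < l x
    · simp only [v, dif_pos he, Option.some.injEq] at h
      exact h ▸ he.choose_spec
    · simp [v, dif_neg he] at h
  have hv' : ∀ T σ, w T σ ≠ 0 → ∃ x, v σ = some x := by
    intro T σ h
    have hle : F.mdeg i σ ≤ l := le_self_add.trans (F.mem_faceStrand.1 (hw T).1 σ h)
    have he : ∃ x, F.mdeg i σ x < l x := by
      by_contra! hcon
      exact h (hl T σ (le_antisymm hle hcon))
    exact ⟨_, dif_pos he⟩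
  let p : Fin n → (F.B i →₀ k) →ₗ[k] (F.B i →₀ k) := fun x =>
    Finsupp.lsum k fun σ => if v σ = some x then Finsupp.lsingle σ else 0
  have hp : ∀ x f σ, p x f σ = if v σ = some x then f σ else 0 := by
    intro x f σ
    simp only [p, Finsupp.lsum_apply, Finsupp.sum_apply]
    rw [Finsupp.sum, Finset.sum_eq_single σ]
    · split_ifs <;> simp
    · intro τ _ hτ
      split_ifs <;> simp [hτ]
    · intro h
      rw [Finsupp.notMem_support_iff.1 h, map_zero, Finsupp.zero_apply]
  refine ⟨∑ x, koszulCone (k := k) x ((p x).compLeft _ w), sum_mem fun x _ => ?_, ?_⟩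
  · have hmem : (p x).compLeft _ w ∈ koszulChains (F.faceStrand l i) j := by
      refine fun T => ⟨F.mem_faceStrand.2 fun σ h => ?_, fun hT => ?_⟩
      · rw [LinearMap.compLeft_apply, Function.comp_apply, hp] at h
        exact F.mem_faceStrand.1 (hw T).1 σ fun h0 => h (by simp [h0])
      · rw [LinearMap.compLeft_apply, Function.comp_apply, (hw T).2 hT, map_zero]
    refine fun T => ⟨?_, koszulCone_eq_zero_of_card x hmem⟩
    unfold koszulCone
    split_ifs with hx
    · refine Submodule.smul_mem _ _ (F.mem_faceStrand.2 fun σ h => ?_)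
      have h1 := F.mem_faceStrand.1 (hmem (T.erase x)).1 σ h
      rw [LinearMap.compLeft_apply, Function.comp_apply, hp] at h
      have h2 := hv σ x (by by_contra h0; simp [h0] at h)
      intro y
      have h3 := h1 y
      -- Adding the apex costs one only in coordinate `x`, where there is room by choice of `x`; the
      -- others are inherited from `T.erase x`.
      rw [Finsupp.add_apply, squarefreeExponent_apply] at h3 ⊢
      by_cases hy : y = x
      · subst hy
        rw [if_pos hx]
        exact h2
      · simpa [hy] using h3
    · exact zero_mem _
  · rw [map_sum]
    rw [Finset.sum_congr rfl fun x _ => koszulBoundary_koszulCone_of_cycle x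
      (by rw [koszulBoundary_compLeft, hw', map_zero])]
    funext T
    ext σ
    rw [Finset.sum_apply, Finsupp.finsetSum_apply]
    simp only [LinearMap.compLeft_apply, Function.comp_apply, hp]
    by_cases h : w T σ = 0
    · simp [h]
    · obtain ⟨x, hx⟩ := hv' T σ h
      simp [hx]

theorem nonempty_koszulHomology_faceSyzygy (hF : F.IsMinimal) (j p : ℕ) :
    Nonempty (koszulHomology (F.faceSyzygy l p) (j + 1) ≃ₗ[k]
      koszulHomology (F.faceSyzygy l (p + 1)) j) := by
  refine nonempty_koszulHomology_shift (F.frame p) (F.faceStrand l (p + 1)) _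
    (F.antitone_faceStrand _) (F.faceSyzygy_succ p) j (fun w hw hw' => ?_) (fun w hw hw' => ?_)
  · refine F.exists_koszulBoundary_eq _ _ (koszulChains_mono (fun T => ?_) j hw) hw'
      fun T σ hσ => F.apply_eq_zero_of_mem_faceSyzygy hF (hw T).1 hσ
    rw [faceSyzygy_succ]
    exact inf_le_left
  · refine F.exists_koszulBoundary_eq _ _ hw hw' fun T σ hσ => ?_
    by_contra h
    -- A nonempty face leaves no room for a generator of multidegree `l`.
    have hT : T.Nonempty := by
      rw [← Finset.card_pos]
      by_contra hT
      exact h (by rw [(hw T).2 (by omega)]; rfl)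
    obtain ⟨x, hx⟩ := hT
    have := F.mem_faceStrand.1 (hw T).1 σ h x
    rw [Finsupp.add_apply, squarefreeExponent_apply, if_pos hx, hσ] at this
    omega

/-- This is where the generators of multidegree `l` appear: on the empty face, the other generators
yield boundaries, while neither syzygies (by minimality) nor boundaries involve these. -/
theorem nonempty_koszulHomology_zero (hF : F.IsMinimal) (p : ℕ) :
    Nonempty (koszulHomology (F.faceSyzygy l p) 0 ≃ₗ[k]
      ({σ : F.B (p + 1) // F.mdeg (p + 1) σ = l} →₀ k)) := by
  classical
  let g : (Finset (Fin n) → F.B (p + 1) →₀ k) →ₗ[k]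
      ({σ : F.B (p + 1) // F.mdeg (p + 1) σ = l} →₀ k) :=
    (Finsupp.lcomapDomain Subtype.val Subtype.val_injective).comp (LinearMap.proj ∅)
  refine nonempty_equiv_of_surjection (koszulChains (F.faceStrand l (p + 1)) 0)
    ((F.frame p).compLeft _) g ?_ ?_ ?_
  · ext c
    constructor
    · rintro ⟨b, hb, rfl⟩
      have := compLeft_mem_koszulChains (f := F.frame p) hb
      exact ⟨this, koszulBoundary_eq_zero_of_mem_koszulChains_zero this⟩
    · rintro ⟨hc, -⟩
      exact exists_compLeft_eq hc
  · rw [eq_top_iff]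
    rintro f -
    refine ⟨Pi.single ∅ (f.mapDomain Subtype.val), fun T => ⟨?_, fun hT => ?_⟩, ?_⟩
    · by_cases hT : T = ∅
      · subst hT
        rw [Pi.single_eq_same, mem_faceStrand]
        intro σ hσ
        by_cases h : F.mdeg (p + 1) σ = l
        · intro x
          simp [h, squarefreeExponent_apply]
        · refine absurd (Finsupp.mapDomain_of_notMem_range _ _ ?_) hσ
          simpa using h
      · rw [Pi.single_eq_of_ne hT]
        exact zero_mem _
    · rw [Pi.single_eq_of_ne]
      rintro rfl
      simp at hT
    · rw [LinearMap.comp_apply, LinearMap.proj_apply, Pi.single_eq_same]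
      exact Finsupp.comapDomain_mapDomain _ Subtype.val_injective f
  · intro c hc
    have hg : g c = 0 ↔ ∀ T σ, F.mdeg (p + 1) σ = l → c T σ = 0 := by
      constructor
      · intro h T σ hσ
        by_cases hT : T = ∅
        · subst hT
          exact DFunLike.congr_fun h ⟨σ, hσ⟩
        · rw [(hc T).2 (by simpa using hT), Finsupp.zero_apply]
      · intro h
        ext σ
        exact h ∅ σ.1 σ.2
    rw [hg]
    constructor
    · rintro ⟨y, hy, hyc⟩ T σ hσ
      obtain ⟨e, he, rfl⟩ := exists_compLeft_eq hy
      rw [koszulBoundary_compLeft] at hyc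
      have h1 : c - koszulBoundary k n _ e ∈ koszulChains (F.faceStrand l (p + 1)) 0 :=
        sub_mem hc (koszulBoundary_mem_koszulChains (F.antitone_faceStrand _) he)
      have h2 : (c - koszulBoundary k n _ e) T ∈ F.faceSyzygy l (p + 1) T := by
        rw [faceSyzygy_succ]
        refine ⟨(h1 T).1, ?_⟩
        rw [SetLike.mem_coe, LinearMap.mem_ker, Pi.sub_apply, map_sub, sub_eq_zero]
        exact (congrFun hyc T).symm
      have h3 := F.apply_eq_zero_of_mem_faceSyzygy hF h2 hσ
      have h4 : koszulBoundary k n _ e T σ = 0 := by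
        rw [koszulBoundary_apply, Finsupp.finsetSum_apply]
        refine Finset.sum_eq_zero fun i _ => ?_
        rw [Finsupp.smul_apply]
        by_contra h
        have h5 := F.mem_faceStrand.1 (he (insert i T)).1 σ (fun h0 => h (by simp [h0])) i
        rw [Finsupp.add_apply, squarefreeExponent_apply, if_pos (by simp), hσ] at h5
        omega
      rw [Pi.sub_apply, Finsupp.sub_apply, h4, sub_zero] at h3
      exact h3
    · intro h
      obtain ⟨u, hu, rfl⟩ := F.exists_koszulBoundary_eq _ _ hc
        (koszulBoundary_eq_zero_of_mem_koszulChains_zero hc) h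
      exact ⟨(F.frame p).compLeft _ u, compLeft_mem_koszulChains hu, koszulBoundary_compLeft _ _⟩

/-- Each shift trades one vertex of the face for one syzygy step, until the empty face is reached.
-/
theorem nonempty_koszulHomology_equiv_basis (hF : F.IsMinimal) (i p : ℕ) :
    Nonempty (koszulHomology (F.faceSyzygy l p) i ≃ₗ[k]
      ({σ : F.B (p + i + 1) // F.mdeg (p + i + 1) σ = l} →₀ k)) := by
  induction i generalizing p with
  | zero => exact F.nonempty_koszulHomology_zero hF p
  | succ i ih =>
    obtain ⟨e⟩ := F.nonempty_koszulHomology_faceSyzygy (l := l) hF i p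
    obtain ⟨e'⟩ := ih (p + 1)
    rw [Nat.add_right_comm p 1 i] at e'
    exact ⟨e.trans e'⟩

/-- The basis elements of multidegree `l` and positive homological degree are counted by the
homology of the upper Koszul complex. -/
theorem nonempty_upperKoszul_equiv (hM : IsMonomialIdeal M) (hM' : M ≠ ⊤) (hF : F.IsMinimal)
    (i : ℕ) :
    Nonempty (koszulHomology (complexFamily k (F.B 0 →₀ k) (upperKoszul M l)) i ≃ₗ[k]
      ({σ : F.B (i + 1) // F.mdeg (i + 1) σ = l} →₀ k)) := by
  obtain ⟨σ₀, huniq, hσ₀, h⟩ := F.exists_unique_generator hF hM hM'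
  have : F.faceSyzygy l 0 = complexFamily k (F.B 0 →₀ k) (upperKoszul M l) := by
    funext T
    ext f
    unfold faceSyzygy complexFamily upperKoszul
    by_cases hT : squarefreeExponent T ≤ l
    · rw [F.faceStrand_eq_strand hT, Submodule.mem_map]
      refine (h _ f).trans ?_
      by_cases h1 : monomial (l - squarefreeExponent T) 1 ∈ M <;> simp [hT, h1]
    · simp [F.faceStrand_eq_bot hT, hT]
  obtain ⟨e⟩ := F.nonempty_koszulHomology_equiv_basis (l := l) hF i 0
  rw [this, Nat.zero_add] at e
  exact ⟨e⟩

theorem count_eq_zero_of_isEmpty {i : ℕ} (h : IsEmpty {σ : F.B i // F.mdeg i σ = l}) :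
    F.count i l = 0 := by
  rw [count, Set.encard_eq_zero, Set.eq_empty_iff_forall_notMem]
  exact fun σ hσ => h.elim ⟨σ, hσ⟩

theorem count_eq_one_of_unique {i : ℕ} (σ₀ : F.B i) (h₀ : F.mdeg i σ₀ = l)
    (h : ∀ σ, F.mdeg i σ = l → σ = σ₀) : F.count i l = 1 := by
  rw [count, Set.encard_eq_one]
  refine ⟨σ₀, Set.ext fun σ => ⟨h σ, ?_⟩⟩
  rintro rfl
  exact h₀

theorem eq_univ_iff_of_mdeg_eq (hM : IsMonomialIdeal M) (hM' : M ≠ ⊤) (hF : F.IsMinimal) {m : ℕ}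
    (hm : m + 1 = n) (σ : F.B (m + 1)) (hσ : F.mdeg (m + 1) σ = l) (T : Finset (Fin n)) :
    upperKoszul M l T ↔ T ≠ Finset.univ := by
  obtain ⟨e⟩ := F.nonempty_upperKoszul_equiv (l := l) hM hM' hF m
  have : Nonempty {σ : F.B (m + 1) // F.mdeg (m + 1) σ = l} := ⟨⟨σ, hσ⟩⟩
  exact eq_univ_iff_of_nontrivial (fun S T => upperKoszul_subset) hm e.toEquiv.nontrivial T

theorem count_eq_of_upperKoszul (hM : IsMonomialIdeal M) (hM' : M ≠ ⊤) (hF : F.IsMinimal)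
    (hn : n ≠ 0) (hl : ∀ T, upperKoszul M l T ↔ T ≠ Finset.univ) (i : ℕ) :
    F.count i l = if i = n then 1 else 0 := by
  obtain ⟨σ₀, huniq, hσ₀, -⟩ := F.exists_unique_generator hF hM hM'
  cases i with
  | zero =>
    rw [if_neg hn.symm]
    refine F.count_eq_zero_of_isEmpty ⟨fun ⟨σ, hσ⟩ => hM' ?_⟩
    rw [huniq σ, hσ₀] at hσ
    -- The empty face puts the monomial of exponent `l` in `M`; for `l = 0` this is 1.
    have h := ((hl ∅).2 fun h => hn (by simpa using congrArg Finset.card h.symm)).2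
    rw [← hσ, zero_tsub] at h
    exact (Ideal.eq_top_iff_one M).2 h
  | succ i =>
    obtain ⟨e⟩ := F.nonempty_upperKoszul_equiv (l := l) hM hM' hF i
    by_cases hi : i + 1 = n
    · rw [if_pos hi]
      obtain ⟨e'⟩ := nonempty_koszulHomology_equiv (k := k) (V := F.B 0 →₀ k) hl hi
      -- Two bases of the same homology space, the second indexed by the one-element set `F.B 0`.
      let b : {σ : F.B (i + 1) // F.mdeg (i + 1) σ = l} ≃ F.B 0 :=
        (Module.Basis.ofRepr e).indexEquiv (Module.Basis.ofRepr e')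
      refine F.count_eq_one_of_unique (b.symm σ₀) (b.symm σ₀).2 fun σ hσ => ?_
      rw [← huniq (b ⟨σ, hσ⟩), Equiv.symm_apply_apply]
    · rw [if_neg hi]
      have := subsingleton_koszulHomology (k := k) (V := F.B 0 →₀ k) hl hi
      have hs := e.symm.toEquiv.subsingleton
      refine F.count_eq_zero_of_isEmpty ⟨fun σ => ?_⟩
      have := DFunLike.congr_fun (Subsingleton.elim (Finsupp.single σ (1 : k)) 0) σ
      simp at this

theorem count_eq_of_fin_zero {M : Ideal (MvPolynomial (Fin 0) k)} (F : FreeResolution M)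
    (hM : IsMonomialIdeal M) (hM' : M ≠ ⊤) (hF : F.IsMinimal) (l : Fin 0 →₀ ℕ) (i : ℕ) :
    F.count i l = if i = 0 then 1 else 0 := by
  obtain ⟨σ₀, huniq, -, -⟩ := F.exists_unique_generator hF hM hM'
  cases i with
  | zero =>
    rw [if_pos rfl]
    exact F.count_eq_one_of_unique σ₀ (Subsingleton.elim _ _) fun σ _ => huniq σ
  | succ i =>
    rw [if_neg (by omega)]
    obtain ⟨e⟩ := F.nonempty_upperKoszul_equiv (l := l) hM hM' hF i
    have hA : ¬ upperKoszul M l ∅ := by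
      rintro ⟨-, h⟩
      rw [Subsingleton.elim (l - squarefreeExponent ∅) 0] at h
      exact hM' ((Ideal.eq_top_iff_one M).2 h)
    have hs : Subsingleton (koszulHomology (complexFamily k (F.B 0 →₀ k) (upperKoszul M l)) i) := by
      refine Submodule.Quotient.subsingleton_iff.2 (eq_top_iff.2 ?_)
      rintro ⟨w, hw, hw'⟩ -
      have : w = 0 := by
        funext T
        have h0 := (hw T).1
        rw [Subsingleton.elim T ∅] at h0 ⊢
        rwa [complexFamily, if_neg hA, Submodule.mem_bot] at h0
      subst this
      exact zero_mem _
    have hs := e.symm.toEquiv.subsingleton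
    refine F.count_eq_zero_of_isEmpty ⟨fun σ => ?_⟩
    have := DFunLike.congr_fun (Subsingleton.elim (Finsupp.single σ (1 : k)) 0) σ
    simp at this

end FreeResolution

end Betti

end MonomialResolution

theorem mainTheorem9 {k : Type u} [Field k] {n : ℕ}
    (M : Ideal (MvPolynomial (Fin n) k)) (hM : MonomialResolution.IsMonomialIdeal M)
    (F : MonomialResolution.FreeResolution M) (hF : F.IsMinimal)
    (l : Fin n →₀ ℕ) (σ : F.B n) (hσ : F.mdeg n σ = l) :
    (∀ i : ℕ, MonomialResolution.multigradedBetti M i l = if i = n then 1 else 0) ∧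
    (∀ F' : MonomialResolution.FreeResolution M, F'.IsMinimal →
      ∀ i : ℕ, F'.count i l = if i = n then 1 else 0) := by
  have hM' : M ≠ ⊤ := fun h => (F.isEmpty_of_eq_top hF h n).elim σ
  have key : ∀ F' : MonomialResolution.FreeResolution M, F'.IsMinimal →
      ∀ i : ℕ, F'.count i l = if i = n then 1 else 0 := by
    intro F' hF' i
    cases n with
    | zero => exact F'.count_eq_of_fin_zero hM hM' hF' l i
    | succ m =>
      -- The shape of the complex is read off from `F` and then applied to `F'`.
      exact F'.count_eq_of_upperKoszul hM hM' hF' m.succ_ne_zero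
        (F.eq_univ_iff_of_mdeg_eq hM hM' hF rfl σ hσ) i
  refine ⟨fun i => ?_, key⟩
  have h : ∃ F : MonomialResolution.FreeResolution M, F.IsMinimal := ⟨F, hF⟩
  rw [MonomialResolution.multigradedBetti, dif_pos h]
  exact key _ h.choose_spec i
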